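/- Let $d\ge 1$, let $\Omega\subset\mathbb R^d$ be a nonempty open convex polytope, let $0<\kappa_{\min}$ and $\kappa_{\max}$ be real numbers, and let $\kappa:\mathbb R\to\mathbb R$ be continuously differentiable and Lipschitz with $\kappa_{\min}\le\kappa\le\kappa_{\max}$. Write $(\cdot,\cdot)$, $\|\cdot\|$ for the inner product and norm of $L^2(\Omega)$, and $(\cdot,\cdot)_{\partial\Omega}$, $\|\cdot\|_{\partial\Omega}$ for those of $L^2(\partial\Omega)$. For a nonnegative bounded measurable weight $w$ put $\|\sqrt w\,\nabla u\|^2=\int_\Omega w|\nabla u|^2$ and $\|\sqrt w\,u\|_1^2=\int_\Omega w(|u|^2+|\nabla u|^2)$. Let $X=H^1(\Omega)$ with norm $\|u\|_1^2=\|u\|^2+\|\nabla u\|^2$. Given a partition $\partial\Omega=\overline{\Gamma_D}\cup\overline{\Gamma_N}$, $\Gamma_D\cap\Gamma_N=\emptyset$, with $\Gamma_D$ of positive surface measure, let $Y=\{u\in H^1(\Omega): u=0 \text{ on }\Gamma_D\}$ (in the sense of traces) with norm $\|\nabla u\|$. Let $\|\cdot\|_{-1}$ be the norm of the dual space of $Y$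 in part (a), and of $X$ in part (b). For a bounded linear functional $\beta$ on the space of traces of $X$, written $S\mapsto(\beta,S)_{\partial\Omega}$, let $\|\beta\|_{-1,\partial\Omega}=\sup_{0\ne S\in X}|(\beta,S)_{\partial\Omega}|/\|S\|_1$. Let $\mathcal T_h$ be any mesh of $\overline\Omega$ into finitely many closed convex polytopes with nonempty, pairwise disjoint interiors, let $l\ge0$, let $X_h\subset X$ be the space of continuous functions on $\overline\Omega$ that are polynomials of degree at most $l$ on each element, and let $Y_h=X_h\cap Y$. Let $t^*>0$, $N\ge1$, $\Delta t=t^*/N$, $f^{n}=f(n\Delta t)$, $\kappa_h^n=\kappa(T_h^n)$ and $\kappa_h'^n=\kappa_{\max}-\kappa_h^n$. (a) Let $f$ take values in the dual of $Y$, and let $T_h^0,\dots,T_h^N\in Y_h$ satisfy, for $0\le n<N$ and all $S_h\in Y_h$, $$\Big(\tfrac{T_h^{n+1}-T_h^n}{\Delta t},S_h\Big)+(\kappa_{\max}\nabla T_h^{n+1},\nabla S_h)-(\kappa_h'^n\nabla T_h^n,\nabla S_h)=(f^{n+1},S_h).$$ Then $$\|T_h^N\|^2+\Delta t\|\sqrt{\kappa_{\max}}\nabla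 T_h^N\|^2+\sum_{n=0}^{N-1}\Big(\|T_h^{n+1}-T_h^n\|^2+\Delta t\|\sqrt{\kappa_h'^n}\nabla(T_h^{n+1}-T_h^n)\|^2\Big)+\frac{\Delta t}{2}\sum_{n=0}^{N-1}\|\sqrt{\kappa_h^n}\nabla T_h^{n+1}\|^2$$ $$\le\|T_h^0\|^2+\Delta t\|\sqrt{\kappa_{\max}}\nabla T_h^0\|^2+\frac{2\Delta t}{\kappa_{\min}}\sum_{n=0}^{N-1}\|f^{n+1}\|_{-1}^2 .$$ (b) Let $\alpha\in(0,1]$. There is a constant $C_P>0$, depending only on $\Omega,\alpha,\kappa_{\min},\kappa_{\max}$, such that $$\frac{C_P^2}{2}\|\sqrt w\,S\|_1^2\le\|\sqrt w\,\nabla S\|^2+\|\sqrt\alpha\,S\|_{\partial\Omega}^2$$ for all $S\in X$ and all measurable $w$ with $\kappa_{\min}\le w\le\kappa_{\max}$, and such that the following holds for all $\kappa$, $\mathcal T_h$, $l$, $t^*$, $N$ as above, every $f$ with values in the dual of $X$ and every $\beta$ as above. If $T_h^0,\dots,T_h^N\in X_h$ satisfy, for $0\le n<N$ and all $S_h\in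 X_h$, $$\Big(\tfrac{T_h^{n+1}-T_h^n}{\Delta t},S_h\Big)+(\kappa_{\max}\nabla T_h^{n+1},\nabla S_h)-(\kappa_h'^n\nabla T_h^n,\nabla S_h)+(\alpha T_h^{n+1},S_h)_{\partial\Omega}=(f^{n+1},S_h)+(\beta,S_h)_{\partial\Omega},$$ then $$\|T_h^N\|^2+\Delta t\|\sqrt{\kappa_{\max}}\nabla T_h^N\|^2+\sum_{n=0}^{N-1}\Big(\|T_h^{n+1}-T_h^n\|^2+\Delta t\|\sqrt{\kappa_h'^n}\nabla(T_h^{n+1}-T_h^n)\|^2\Big)+\frac{C_P^2\Delta t}{8}\sum_{n=0}^{N-1}\|\sqrt{\kappa_h^n}\,T_h^{n+1}\|_1^2$$ $$\le\|T_h^0\|^2+\Delta t\|\sqrt{\kappa_{\max}}\nabla T_h^0\|^2+\frac{4\Delta t}{C_P^2\kappa_{\min}}\sum_{n=0}^{N-1}\Big(\|f^{n+1}\|_{-1}^2+2\|\beta\|_{-1,\partial\Omega}^2\Big).$$ -/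

import Mathlib

open MeasureTheory Set
open scoped ContDiff ENNReal

noncomputable section

namespace HeatIMEX

/-! ### Domain and boundary -/

/-- The Euclidean space `ℝ^d`. -/
abbrev Pt (d : ℕ) : Type := EuclideanSpace ℝ (Fin d)

/-- `Ω` is a nonempty open convex polytope: the interior of the convex hull of finitely many
points. Such a set is open, bounded, convex and Lipschitz. -/
def IsConvexPolytope {d : ℕ} (Ω : Set (Pt d)) : Prop :=
  Ω.Nonempty ∧ ∃ F : Finset (Pt d), Ω = interior (convexHull ℝ (F : Set (Pt d)))

/-- Surface measure on `∂Ω`: the `(d-1)`-dimensional Hausdorff measure (normalised so that it is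
Lebesgue measure on hyperplanes) restricted to the boundary. -/
def surf {d : ℕ} (Ω : Set (Pt d)) : Measure (Pt d) :=
  (Measure.euclideanHausdorffMeasure (d - 1) : Measure (Pt d)).restrict (frontier Ω)

/-- The boundary is partitioned into a Dirichlet part of positive surface measure and a
Neumann part. -/
structure IsBoundaryPartition {d : ℕ} (Ω ΓD ΓN : Set (Pt d)) : Prop where
  union : frontier Ω = closure ΓD ∪ closure ΓN
  disjoint : Disjoint ΓD ΓN
  pos : 0 < surf Ω ΓD

/-! ### Sobolev spaces -/

/-- `L²(Ω)`. -/
abbrev L2 {d : ℕ} (Ω : Set (Pt d)) : Type := Lp ℝ 2 (volume.restrict Ω)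

/-- `L²(Ω; ℝ^d)`. -/
abbrev L2Vec {d : ℕ} (Ω : Set (Pt d)) : Type := Lp (Pt d) 2 (volume.restrict Ω)

/-- `L²(∂Ω)`. -/
abbrev L2Bdry {d : ℕ} (Ω : Set (Pt d)) : Type := Lp ℝ 2 (surf Ω)

/-- `g` is the weak (distributional) gradient of `u` on `Ω`, tested against `C_c^∞(Ω)`. -/
def IsWeakGradient {d : ℕ} (Ω : Set (Pt d)) (u : Pt d → ℝ) (g : Pt d → Pt d) : Prop :=
  ∀ φ : Pt d → ℝ, ContDiff ℝ ∞ φ → HasCompactSupport φ → tsupport φ ⊆ Ω →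
    ∫ x in Ω, u x • gradient φ x = - ∫ x in Ω, φ x • g x

lemma memLp_test {d : ℕ} (Ω : Set (Pt d)) {φ : Pt d → ℝ} (h : ContDiff ℝ ∞ φ)
    (hc : HasCompactSupport φ) : MemLp φ 2 (volume.restrict Ω) :=
  (h.continuous.memLp_of_hasCompactSupport hc).restrict Ω

lemma memLp_gradient_test {d : ℕ} (Ω : Set (Pt d)) {φ : Pt d → ℝ} (h : ContDiff ℝ ∞ φ)
    (hc : HasCompactSupport φ) : MemLp (gradient φ) 2 (volume.restrict Ω) := by
  have h1 : Continuous (gradient φ) :=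
    (InnerProductSpace.toDual ℝ (Pt d)).symm.continuous.comp (h.continuous_fderiv (by simp))
  have h2 : HasCompactSupport (gradient φ) :=
    (hc.fderiv ℝ).comp_left (g := (InnerProductSpace.toDual ℝ (Pt d)).symm) (map_zero _)
  exact (h1.memLp_of_hasCompactSupport h2).restrict Ω

lemma integrable_mul_test {d : ℕ} (Ω : Set (Pt d)) {u : Pt d → ℝ} {v : Pt d → Pt d}
    (hu : MemLp u 2 (volume.restrict Ω)) (hv : MemLp v 2 (volume.restrict Ω)) :
    Integrable (fun x => u x • v x) (volume.restrict Ω) :=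
  memLp_one_iff_integrable.1 (hv.smul hu)

/-- `H¹(Ω)`: pairs `(u, ∇u)` in `L²(Ω) × L²(Ω; ℝ^d)` whose second entry is the weak gradient of
the first. It carries the inherited Hilbert norm `‖u‖₁² = ‖u‖² + ‖∇u‖²`. -/
def H1 {d : ℕ} (Ω : Set (Pt d)) : Submodule ℝ (WithLp 2 (L2 Ω × L2Vec Ω)) where
  carrier := {p | IsWeakGradient Ω p.fst p.snd}
  add_mem' := by
    intro p q hp hq φ h hc hs
    have i1 := integrable_mul_test Ω (Lp.memLp p.fst) (memLp_gradient_test Ω h hc)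
    have i2 := integrable_mul_test Ω (Lp.memLp q.fst) (memLp_gradient_test Ω h hc)
    have j1 := integrable_mul_test Ω (memLp_test Ω h hc) (Lp.memLp p.snd)
    have j2 := integrable_mul_test Ω (memLp_test Ω h hc) (Lp.memLp q.snd)
    have e1 : ∫ x in Ω, (p + q).fst x • gradient φ x
        = ∫ x in Ω, (p.fst x • gradient φ x + q.fst x • gradient φ x) := by
      refine integral_congr_ae ?_
      filter_upwards [Lp.coeFn_add p.fst q.fst] with x hx
      rw [WithLp.add_fst, hx, Pi.add_apply, add_smul]
    have e2 : ∫ x in Ω, φ x • (p + q).snd x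
        = ∫ x in Ω, (φ x • p.snd x + φ x • q.snd x) := by
      refine integral_congr_ae ?_
      filter_upwards [Lp.coeFn_add p.snd q.snd] with x hx
      rw [WithLp.add_snd, hx, Pi.add_apply, smul_add]
    rw [e1, e2, integral_add i1 i2, integral_add j1 j2, hp φ h hc hs, hq φ h hc hs, neg_add]
  zero_mem' := by
    intro φ h hc hs
    have e1 : ∫ x in Ω, (0 : WithLp 2 (L2 Ω × L2Vec Ω)).fst x • gradient φ x
        = ∫ x in Ω, (0 : Pt d) := by
      refine integral_congr_ae ?_
      filter_upwards [Lp.coeFn_zero ℝ 2 (volume.restrict Ω)] with x hx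
      rw [WithLp.zero_fst, hx, Pi.zero_apply, zero_smul]
    have e2 : ∫ x in Ω, φ x • (0 : WithLp 2 (L2 Ω × L2Vec Ω)).snd x
        = ∫ x in Ω, (0 : Pt d) := by
      refine integral_congr_ae ?_
      filter_upwards [Lp.coeFn_zero (Pt d) 2 (volume.restrict Ω)] with x hx
      rw [WithLp.zero_snd, hx, Pi.zero_apply, smul_zero]
    rw [e1, e2]; simp
  smul_mem' := by
    intro c p hp φ h hc hs
    have e1 : ∫ x in Ω, (c • p).fst x • gradient φ x
        = ∫ x in Ω, c • (p.fst x • gradient φ x) := by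
      refine integral_congr_ae ?_
      filter_upwards [Lp.coeFn_smul c p.fst] with x hx
      rw [WithLp.smul_fst, hx, Pi.smul_apply, smul_eq_mul, mul_smul]
    have e2 : ∫ x in Ω, φ x • (c • p).snd x
        = ∫ x in Ω, c • (φ x • p.snd x) := by
      refine integral_congr_ae ?_
      filter_upwards [Lp.coeFn_smul c p.snd] with x hx
      rw [WithLp.smul_snd, hx, Pi.smul_apply, smul_comm]
    rw [e1, e2, integral_smul, integral_smul, hp φ h hc hs, smul_neg]

/-- The underlying `L²` function of an `H¹` function. -/
def val {d : ℕ} {Ω : Set (Pt d)} : H1 Ω →ₗ[ℝ] L2 Ω where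
  toFun u := u.1.fst
  map_add' _ _ := rfl
  map_smul' _ _ := rfl

/-- The weak gradient of an `H¹` function. -/
def grad {d : ℕ} {Ω : Set (Pt d)} : H1 Ω →ₗ[ℝ] L2Vec Ω where
  toFun u := u.1.snd
  map_add' _ _ := rfl
  map_smul' _ _ := rfl

/-- Pairs `(φ|_Ω, φ|_∂Ω)` for smooth functions `φ` on `ℝ^d`. -/
def smoothTraces {d : ℕ} (Ω : Set (Pt d)) : Submodule ℝ (H1 Ω × L2Bdry Ω) where
  carrier := {p | ∃ φ : Pt d → ℝ, ContDiff ℝ ∞ φ ∧ val p.1 =ᵐ[volume.restrict Ω] φ ∧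
    grad p.1 =ᵐ[volume.restrict Ω] gradient φ ∧ p.2 =ᵐ[surf Ω] φ}
  add_mem' := by
    rintro p q ⟨φ, h1, h2, h3, h4⟩ ⟨ψ, k1, k2, k3, k4⟩
    refine ⟨fun x => φ x + ψ x, h1.add k1, ?_, ?_, ?_⟩
    · filter_upwards [Lp.coeFn_add (val p.1) (val q.1), h2, k2] with x hx hx1 hx2
      rw [Prod.fst_add, map_add, hx, Pi.add_apply, hx1, hx2]
    · filter_upwards [Lp.coeFn_add (grad p.1) (grad q.1), h3, k3] with x hx hx1 hx2
      rw [Prod.fst_add, map_add, hx, Pi.add_apply, hx1, hx2]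
      have d1 : DifferentiableAt ℝ φ x := (h1.differentiable (by simp)) x
      have d2 : DifferentiableAt ℝ ψ x := (k1.differentiable (by simp)) x
      simp only [gradient]
      rw [fderiv_fun_add d1 d2, map_add]
    · filter_upwards [Lp.coeFn_add p.2 q.2, h4, k4] with x hx hx1 hx2
      rw [Prod.snd_add, hx, Pi.add_apply, hx1, hx2]
  zero_mem' := by
    refine ⟨fun _ => 0, contDiff_const, ?_, ?_, ?_⟩
    · filter_upwards [Lp.coeFn_zero ℝ 2 (volume.restrict Ω)] with x hx
      rw [Prod.fst_zero, map_zero, hx, Pi.zero_apply]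
    · filter_upwards [Lp.coeFn_zero (Pt d) 2 (volume.restrict Ω)] with x hx
      rw [Prod.fst_zero, map_zero, hx, Pi.zero_apply]
      simp [gradient]
    · filter_upwards [Lp.coeFn_zero ℝ 2 (surf Ω)] with x hx
      rw [Prod.snd_zero, hx, Pi.zero_apply]
  smul_mem' := by
    rintro c p ⟨φ, h1, h2, h3, h4⟩
    refine ⟨fun x => c * φ x, contDiff_const.mul h1, ?_, ?_, ?_⟩
    · filter_upwards [Lp.coeFn_smul c (val p.1), h2] with x hx hx1
      rw [Prod.smul_fst, map_smul, hx, Pi.smul_apply, hx1, smul_eq_mul]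
    · filter_upwards [Lp.coeFn_smul c (grad p.1), h3] with x hx hx1
      rw [Prod.smul_fst, map_smul, hx, Pi.smul_apply, hx1]
      have d1 : DifferentiableAt ℝ φ x := (h1.differentiable (by simp)) x
      simp only [gradient]
      rw [fderiv_const_mul d1, map_smul]
    · filter_upwards [Lp.coeFn_smul c p.2, h4] with x hx hx1
      rw [Prod.smul_snd, hx, Pi.smul_apply, hx1, smul_eq_mul]

/-- The graph of the trace operator `H¹(Ω) → L²(∂Ω)`: the closure of restriction to the boundary
on smooth functions. -/
def traceGraph {d : ℕ} (Ω : Set (Pt d)) : Submodule ℝ (H1 Ω × L2Bdry Ω) :=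
  (smoothTraces Ω).topologicalClosure

/-- `s ∈ L²(∂Ω)` is the trace of `u ∈ H¹(Ω)`. -/
def HasTrace {d : ℕ} {Ω : Set (Pt d)} (u : H1 Ω) (s : L2Bdry Ω) : Prop :=
  (u, s) ∈ traceGraph Ω

/-- `Y = {u ∈ H¹(Ω) : u = 0 on Γ_D}` in the sense of traces, as a subspace of `H¹(Ω)`. -/
def subY {d : ℕ} (Ω ΓD : Set (Pt d)) : Submodule ℝ (H1 Ω) where
  carrier := {u | ∃ s : L2Bdry Ω, HasTrace u s ∧ ∀ᵐ x ∂(surf Ω), x ∈ ΓD → s x = 0}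
  add_mem' := by
    rintro u v ⟨s, hs, hs0⟩ ⟨t, ht, ht0⟩
    refine ⟨s + t, (traceGraph Ω).add_mem hs ht, ?_⟩
    filter_upwards [Lp.coeFn_add s t, hs0, ht0] with x hx h1 h2 hxD
    rw [hx, Pi.add_apply, h1 hxD, h2 hxD, add_zero]
  zero_mem' := by
    refine ⟨0, (traceGraph Ω).zero_mem, ?_⟩
    filter_upwards [Lp.coeFn_zero ℝ 2 (surf Ω)] with x hx _
    rw [hx, Pi.zero_apply]
  smul_mem' := by
    rintro c u ⟨s, hs, hs0⟩
    refine ⟨c • s, (traceGraph Ω).smul_mem c hs, ?_⟩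
    filter_upwards [Lp.coeFn_smul c s, hs0] with x hx h1 hxD
    rw [hx, Pi.smul_apply, h1 hxD, smul_zero]

/-- The space `Y`, normed by `u ↦ ‖∇u‖` (equivalent to the `H¹` norm on `Y` by the
Poincaré–Friedrichs inequality). A type synonym of `subY`, so that the norm is not the one
inherited from `H¹(Ω)`. -/
def Y {d : ℕ} (Ω ΓD : Set (Pt d)) : Type := ↥(subY Ω ΓD)

instance {d : ℕ} (Ω ΓD : Set (Pt d)) : AddCommGroup (Y Ω ΓD) :=
  inferInstanceAs (AddCommGroup ↥(subY Ω ΓD))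

instance {d : ℕ} (Ω ΓD : Set (Pt d)) : Module ℝ (Y Ω ΓD) :=
  inferInstanceAs (Module ℝ ↥(subY Ω ΓD))

/-- The inclusion `Y ⊆ H¹(Ω)`. -/
def Y.toH1 {d : ℕ} {Ω ΓD : Set (Pt d)} : Y Ω ΓD →ₗ[ℝ] H1 Ω := (subY Ω ΓD).subtype

instance {d : ℕ} (Ω ΓD : Set (Pt d)) : SeminormedAddCommGroup (Y Ω ΓD) :=
  SeminormedAddCommGroup.induced (Y Ω ΓD) (L2Vec Ω) (grad ∘ₗ Y.toH1)

instance {d : ℕ} (Ω ΓD : Set (Pt d)) : NormedSpace ℝ (Y Ω ΓD) :=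
  NormedSpace.induced ℝ (Y Ω ΓD) (L2Vec Ω) (grad ∘ₗ Y.toH1)

lemma Y.norm_def {d : ℕ} {Ω ΓD : Set (Pt d)} (u : Y Ω ΓD) : ‖u‖ = ‖grad u.toH1‖ := rfl

/-- Bounded functionals on `H¹(Ω)` that depend on the trace only, i.e. functionals
`S ↦ (β, S)_∂Ω` on the trace space of `H¹(Ω)`. The inherited norm is
`‖β‖_{-1,∂Ω} = sup (β, S)_∂Ω / ‖S‖₁`. -/
def BdryDual {d : ℕ} (Ω : Set (Pt d)) : Submodule ℝ (StrongDual ℝ (H1 Ω)) where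
  carrier := {β | ∀ u : H1 Ω, HasTrace u 0 → β u = 0}
  add_mem' := by
    intro a b ha hb u hu
    simp [ha u hu, hb u hu]
  zero_mem' := by
    intro u _
    simp
  smul_mem' := by
    intro c a ha u hu
    simp [ha u hu]

/-! ### Finite elements -/

/-- A mesh of `Ω`: finitely many closed convex polytopes with nonempty, pairwise disjoint
interiors that cover the closure of `Ω` (simplicial meshes in particular). -/
structure IsMesh {d : ℕ} (Ω : Set (Pt d)) (𝒯 : Set (Set (Pt d))) : Prop where
  finite : 𝒯.Finite
  polytope : ∀ K ∈ 𝒯, ∃ F : Finset (Pt d), K = convexHull ℝ (F : Set (Pt d))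
  nonempty_interior : ∀ K ∈ 𝒯, (interior K).Nonempty
  disjoint_interior : ∀ K ∈ 𝒯, ∀ K' ∈ 𝒯, K ≠ K' → Disjoint (interior K) (interior K')
  cover : ⋃₀ 𝒯 = closure Ω

/-- The conforming finite element space `X_h`: elements of `H¹(Ω)` represented by a function that is
continuous on the closure of `Ω` and agrees on each element with a polynomial of total degree at
most `l`. -/
def Xh {d : ℕ} (Ω : Set (Pt d)) (𝒯 : Set (Set (Pt d))) (l : ℕ) : Set (H1 Ω) :=
  {u | ∃ v : Pt d → ℝ, val u =ᵐ[volume.restrict Ω] v ∧ ContinuousOn v (closure Ω) ∧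
    ∀ K ∈ 𝒯, ∃ p : MvPolynomial (Fin d) ℝ, p.totalDegree ≤ l ∧
      ∀ x ∈ K, v x = MvPolynomial.eval (fun i => x i) p}

/-- The conforming finite element space `Y_h = Y ∩ X_h`. -/
def Yh {d : ℕ} (Ω ΓD : Set (Pt d)) (𝒯 : Set (Set (Pt d))) (l : ℕ) : Set (Y Ω ΓD) :=
  {u | u.toH1 ∈ Xh Ω 𝒯 l}

/-! ### Conductivity and schemes -/

/-- Admissible conductivities: continuously differentiable, Lipschitz, and bounded below and above
by `κmin` and `κmax`. -/
structure IsConductivity (κmin κmax : ℝ) (κ : ℝ → ℝ) : Prop where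
  contDiff : ContDiff ℝ 1 κ
  lipschitz : ∃ C : ℝ, ∀ a b, |κ a - κ b| ≤ C * |a - b|
  lower : ∀ a, κmin ≤ κ a
  upper : ∀ a, κ a ≤ κmax

/-- The weighted form `(w ∇u, ∇v)`. -/
def wForm {d : ℕ} {Ω : Set (Pt d)} (w : Pt d → ℝ) (u v : H1 Ω) : ℝ :=
  ∫ x in Ω, w x * inner ℝ (grad u x) (grad v x)

/-- `‖√w ∇u‖²`. -/
def wGradSq {d : ℕ} {Ω : Set (Pt d)} (w : Pt d → ℝ) (u : H1 Ω) : ℝ :=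
  ∫ x in Ω, w x * ‖grad u x‖ ^ 2

/-- The weighted `H¹` norm squared, `‖√w u‖₁² = ‖√w u‖² + ‖√w ∇u‖²`. -/
def wH1Sq {d : ℕ} {Ω : Set (Pt d)} (w : Pt d → ℝ) (u : H1 Ω) : ℝ :=
  ∫ x in Ω, w x * (val u x ^ 2 + ‖grad u x‖ ^ 2)

/-- Algorithm (a), mixed conditions. `T 0, …, T N ∈ Y_h` and, for `n < N` and all `S ∈ Y_h`,
`((T^{n+1} - T^n)/Δt, S) + (κmax ∇T^{n+1}, ∇S) - ((κmax - κ(T^n)) ∇T^n, ∇S) = (f^{n+1}, S)`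
with `f^{n+1} = f ((n+1) Δt)`. -/
def SchemeA {d : ℕ} {Ω ΓD : Set (Pt d)} (κmax : ℝ) (κ : ℝ → ℝ) (𝒯 : Set (Set (Pt d))) (l : ℕ)
    (Δt : ℝ) (N : ℕ) (f : ℝ → StrongDual ℝ (Y Ω ΓD)) (T : ℕ → Y Ω ΓD) : Prop :=
  (∀ n ≤ N, T n ∈ Yh Ω ΓD 𝒯 l) ∧
  ∀ n < N, ∀ S ∈ Yh Ω ΓD 𝒯 l,
    inner ℝ (Δt⁻¹ • (val (T (n + 1)).toH1 - val (T n).toH1)) (val S.toH1)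
      + wForm (fun _ => κmax) (T (n + 1)).toH1 S.toH1
      - wForm (fun x => κmax - κ (val (T n).toH1 x)) (T n).toH1 S.toH1
    = f ((n + 1 : ℝ) * Δt) S

/-- Algorithm (b), Robin conditions. `T 0, …, T N ∈ X_h` with traces `τ 0, …, τ N` and, for `n < N`
and all `S ∈ X_h` with trace `s`,
`((T^{n+1} - T^n)/Δt, S) + (κmax ∇T^{n+1}, ∇S) - ((κmax - κ(T^n)) ∇T^n, ∇S) + (α T^{n+1}, S)_∂Ω
  = (f^{n+1}, S) + (β, S)_∂Ω`. -/
def SchemeB {d : ℕ} {Ω : Set (Pt d)} (κmax α : ℝ) (κ : ℝ → ℝ) (𝒯 : Set (Set (Pt d))) (l : ℕ)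
    (Δt : ℝ) (N : ℕ) (f : ℝ → StrongDual ℝ (H1 Ω)) (β : BdryDual Ω) (T : ℕ → H1 Ω)
    (τ : ℕ → L2Bdry Ω) : Prop :=
  (∀ n ≤ N, T n ∈ Xh Ω 𝒯 l ∧ HasTrace (T n) (τ n)) ∧
  ∀ n < N, ∀ S ∈ Xh Ω 𝒯 l, ∀ s : L2Bdry Ω, HasTrace S s →
    inner ℝ (Δt⁻¹ • (val (T (n + 1)) - val (T n))) (val S)
      + wForm (fun _ => κmax) (T (n + 1)) S
      - wForm (fun x => κmax - κ (val (T n) x)) (T n) S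
      + α * inner ℝ (τ (n + 1)) s
    = f ((n + 1 : ℝ) * Δt) S + (β : StrongDual ℝ (H1 Ω)) S

/-- `‖T^N‖² + Δt ‖√κmax ∇T^N‖² + ∑_{n<N} (‖T^{n+1} - T^n‖² + Δt ‖√(κmax - κ(T^n)) ∇(T^{n+1} - T^n)‖²)`:
the final energy plus the numerical dissipation. -/
def energyDissipation {d : ℕ} {Ω : Set (Pt d)} (κmax : ℝ) (κ : ℝ → ℝ) (Δt : ℝ) (N : ℕ)
    (T : ℕ → H1 Ω) : ℝ :=
  ‖val (T N)‖ ^ 2 + Δt * wGradSq (fun _ => κmax) (T N)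
    + ∑ n ∈ Finset.range N, (‖val (T (n + 1)) - val (T n)‖ ^ 2
      + Δt * wGradSq (fun x => κmax - κ (val (T n) x)) (T (n + 1) - T n))

/-- `C_P` satisfies the weighted Poincaré-type inequality
`(C_P²/2) ‖√w S‖₁² ≤ ‖√w ∇S‖² + ‖√α S‖²_∂Ω` on `H¹(Ω)`, uniformly over weights
`κmin ≤ w ≤ κmax`. -/
def IsPoincareConst {d : ℕ} (Ω : Set (Pt d)) (κmin κmax α CP : ℝ) : Prop :=
  ∀ w : Pt d → ℝ, Measurable w → (∀ x, κmin ≤ w x ∧ w x ≤ κmax) →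
    ∀ (S : H1 Ω) (s : L2Bdry Ω), HasTrace S s →
      CP ^ 2 / 2 * wH1Sq w S ≤ wGradSq w S + α * ‖s‖ ^ 2

end HeatIMEX

end

/-!
The proof has two independent ingredients.

*The discrete energy law.* Testing a step with the new iterate `b = T^{n+1}` (and writing
`a = T^n`, `w = κ(T^n)`), polarisation of both the time difference and the explicit form
`((κmax - w) ∇a, ∇b)` turns twice the left-hand side into the increment of
`‖·‖² + Δt ‖√κmax ∇·‖²`, plus the dissipation terms, plus `Δt ‖√w ∇b‖²`, plus the nonnegative
`Δt ‖√w ∇a‖²`, which is dropped (`two_mul_imex_diffusion`, `energy_step`). These are identities up to the dropped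
term, so no restriction on `Δt` is needed. The load is absorbed into the
coercive term by Young's inequality (`absorb_load_gradient`, `absorb_load_boundary`) and the
one-step bounds are summed (`sum_energy_steps`). Only the fact that `T^{n+1}` is itself an admissible
test function is needed from the finite element space.

*The Poincaré inequality with boundary term*, which supplies `CP` in the Robin case. For smooth `φ`,
slice `Ω` along the first coordinate. Each slice is an interval `(a, b)` whose lower end lies on
`∂Ω`, and integrating the derivative of `(t - b) φ²` bounds `∫ φ²` on the slice by the value at the
lower end and `∫ |∂₁φ|²` (`integral_sq_le_endpoint`). Integrating over the shadow of `Ω` in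
`ℝ^(d-1)`, the lower-end values are bounded by `∫_∂Ω φ²`: the projection onto the shadow is
`1`-Lipschitz, so it does not increase the `(d-1)`-dimensional Hausdorff measure
(`map_lowerPt_le_surf`). Traces are defined by closing the graph of restriction on smooth functions,
and the inequality is a closed condition on that graph (`norm_val_sq_le_of_hasTrace`).
-/

namespace HeatIMEX

/-! ### Weighted forms -/

lemma norm_sq_eq_integral {X E : Type*} [MeasurableSpace X] {μ : Measure X}
    [NormedAddCommGroup E] [InnerProductSpace ℝ E] (g : Lp E 2 μ) :
    ‖g‖ ^ 2 = ∫ x, ‖g x‖ ^ 2 ∂μ := by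
  rw [← real_inner_self_eq_norm_sq, L2.inner_def]
  simp only [real_inner_self_eq_norm_sq]

section Energy

variable {d : ℕ} {Ω : Set (Pt d)}

lemma integrable_weight_mul_inner {w : Pt d → ℝ} (hw : Measurable w) {M : ℝ}
    (hM : ∀ x, |w x| ≤ M) (u v : H1 Ω) :
    Integrable (fun x => w x * inner ℝ (grad u x) (grad v x)) (volume.restrict Ω) :=
  (L2.integrable_inner (𝕜 := ℝ) (grad u) (grad v)).bdd_mul hw.aestronglyMeasurable
    (Filter.Eventually.of_forall hM)

lemma integrable_norm_grad_sq (u : H1 Ω) :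
    Integrable (fun x => ‖grad u x‖ ^ 2) (volume.restrict Ω) := by
  simpa only [real_inner_self_eq_norm_sq] using L2.integrable_inner (𝕜 := ℝ) (grad u) (grad u)

lemma integrable_val_sq (u : H1 Ω) :
    Integrable (fun x => val u x ^ 2) (volume.restrict Ω) :=
  (Lp.memLp (val u)).integrable_sq

lemma norm_grad_sq_eq (u : H1 Ω) : ‖grad u‖ ^ 2 = ∫ x in Ω, ‖grad u x‖ ^ 2 :=
  norm_sq_eq_integral (grad u)

lemma norm_val_sq_eq (u : H1 Ω) : ‖val u‖ ^ 2 = ∫ x in Ω, val u x ^ 2 := by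
  simp only [norm_sq_eq_integral, Real.norm_eq_abs, sq_abs]

lemma norm_H1_sq (u : H1 Ω) : ‖u‖ ^ 2 = ‖val u‖ ^ 2 + ‖grad u‖ ^ 2 :=
  WithLp.prod_norm_sq_eq_of_L2 u.1

lemma wGradSq_eq_wForm (w : Pt d → ℝ) (u : H1 Ω) : wGradSq w u = wForm w u u := by
  simp only [wGradSq, wForm, real_inner_self_eq_norm_sq]

lemma wForm_comm (w : Pt d → ℝ) (u v : H1 Ω) : wForm w u v = wForm w v u := by
  simp only [wForm, real_inner_comm (grad u _)]

lemma wForm_sub_weight {w w' : Pt d → ℝ} (hw : Measurable w) (hw' : Measurable w') {M M' : ℝ}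
    (hM : ∀ x, |w x| ≤ M) (hM' : ∀ x, |w' x| ≤ M') (u v : H1 Ω) :
    wForm (fun x => w x - w' x) u v = wForm w u v - wForm w' u v := by
  simp only [wForm, sub_mul]
  exact integral_sub (integrable_weight_mul_inner hw hM u v)
    (integrable_weight_mul_inner hw' hM' u v)

lemma wForm_sub_left {w : Pt d → ℝ} (hw : Measurable w) {M : ℝ} (hM : ∀ x, |w x| ≤ M)
    (u u' v : H1 Ω) : wForm w (u - u') v = wForm w u v - wForm w u' v := by
  simp only [wForm]
  rw [← integral_sub (integrable_weight_mul_inner hw hM u v)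
    (integrable_weight_mul_inner hw hM u' v)]
  refine integral_congr_ae ?_
  filter_upwards [Lp.coeFn_sub (grad u) (grad u')] with x hx
  rw [map_sub, hx, Pi.sub_apply, inner_sub_left, mul_sub]

lemma wGradSq_nonneg {w : Pt d → ℝ} (hw : ∀ x, 0 ≤ w x) (u : H1 Ω) : 0 ≤ wGradSq w u :=
  integral_nonneg fun x => mul_nonneg (hw x) (sq_nonneg _)

lemma le_wGradSq {w : Pt d → ℝ} (hw : Measurable w) {c M : ℝ} (hc : ∀ x, c ≤ w x)
    (hM : ∀ x, |w x| ≤ M) (u : H1 Ω) : c * ‖grad u‖ ^ 2 ≤ wGradSq w u := by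
  rw [norm_grad_sq_eq, ← integral_const_mul]
  refine integral_mono ((integrable_norm_grad_sq u).const_mul c) ?_
    fun x => mul_le_mul_of_nonneg_right (hc x) (sq_nonneg _)
  simpa only [real_inner_self_eq_norm_sq] using integrable_weight_mul_inner hw hM u u

lemma integrable_weight_mul_H1 {w : Pt d → ℝ} (hw : Measurable w) {M : ℝ}
    (hM : ∀ x, |w x| ≤ M) (u : H1 Ω) :
    Integrable (fun x => w x * (val u x ^ 2 + ‖grad u x‖ ^ 2)) (volume.restrict Ω) :=
  ((integrable_val_sq u).add (integrable_norm_grad_sq u)).bdd_mul hw.aestronglyMeasurable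
    (Filter.Eventually.of_forall hM)

lemma norm_H1_sq_eq_integral (u : H1 Ω) :
    ‖u‖ ^ 2 = ∫ x in Ω, (val u x ^ 2 + ‖grad u x‖ ^ 2) := by
  rw [norm_H1_sq, norm_val_sq_eq, norm_grad_sq_eq,
    integral_add (integrable_val_sq u) (integrable_norm_grad_sq u)]

lemma le_wH1Sq {w : Pt d → ℝ} (hw : Measurable w) {c M : ℝ} (hc : ∀ x, c ≤ w x)
    (hM : ∀ x, |w x| ≤ M) (u : H1 Ω) : c * ‖u‖ ^ 2 ≤ wH1Sq w u := by
  rw [norm_H1_sq_eq_integral, ← integral_const_mul]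
  exact integral_mono
    (((integrable_val_sq u).add (integrable_norm_grad_sq u)).const_mul c)
    (integrable_weight_mul_H1 hw hM u)
    fun x => mul_le_mul_of_nonneg_right (hc x) (by positivity)

lemma wH1Sq_le {w : Pt d → ℝ} (hw : Measurable w) {C M : ℝ} (hC : ∀ x, w x ≤ C)
    (hM : ∀ x, |w x| ≤ M) (u : H1 Ω) : wH1Sq w u ≤ C * ‖u‖ ^ 2 := by
  rw [norm_H1_sq_eq_integral, ← integral_const_mul]
  exact integral_mono (integrable_weight_mul_H1 hw hM u)
    (((integrable_val_sq u).add (integrable_norm_grad_sq u)).const_mul C)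
    fun x => mul_le_mul_of_nonneg_right (hC x) (by positivity)

/-! ### The discrete energy law -/

/-- Polarisation of the implicit-explicit diffusion term. Treating the full `κmax` implicitly and
the nonnegative excess `κmax - w` explicitly turns the energy of the step into a difference of
`κmax`-energies plus nonnegative terms. -/
lemma two_mul_imex_diffusion {κmax M : ℝ} {w : Pt d → ℝ} (hw : Measurable w)
    (hM : ∀ x, |w x| ≤ M) (a b : H1 Ω) :
    2 * (wForm (fun _ => κmax) b b - wForm (fun x => κmax - w x) a b)
      = wGradSq (fun _ => κmax) b - wGradSq (fun _ => κmax) a + wGradSq w b + wGradSq w a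
        + wGradSq (fun x => κmax - w x) (b - a) := by
  have hc : ∀ _ : Pt d, |κmax| ≤ |κmax| := fun _ => le_rfl
  have hw' : Measurable fun x => κmax - w x := measurable_const.sub hw
  have hM' : ∀ x, |κmax - w x| ≤ |κmax| + M := fun x =>
    (abs_sub _ _).trans (add_le_add le_rfl (hM x))
  have hsub := fun u v : H1 Ω => wForm_sub_weight (measurable_const (a := κmax)) hw hc hM u v
  simp only [wGradSq_eq_wForm]
  rw [wForm_sub_left hw' hM', wForm_comm _ b (b - a), wForm_comm _ a (b - a),
    wForm_sub_left hw' hM', wForm_sub_left hw' hM', wForm_comm _ b a]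
  simp only [hsub]
  ring

/-- The energy law of one time step. Here `D` stands for the boundary term and `R` for the load,
both tested with the new iterate `b`. -/
lemma energy_step {κmax M Δt D R : ℝ} (hΔt : 0 < Δt) {w : Pt d → ℝ} (hw : Measurable w)
    (hw0 : ∀ x, 0 ≤ w x) (hM : ∀ x, |w x| ≤ M) (a b : H1 Ω)
    (h : inner ℝ (Δt⁻¹ • (val b - val a)) (val b) + wForm (fun _ => κmax) b b
      - wForm (fun x => κmax - w x) a b + D = R) :
    (‖val b‖ ^ 2 + Δt * wGradSq (fun _ => κmax) b)
      + (‖val b - val a‖ ^ 2 + Δt * wGradSq (fun x => κmax - w x) (b - a))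
      + Δt * (wGradSq w b + 2 * D - 2 * R)
    ≤ ‖val a‖ ^ 2 + Δt * wGradSq (fun _ => κmax) a := by
  have hpol := two_mul_imex_diffusion (κmax := κmax) hw hM a b
  have hinner : 2 * inner ℝ (val b - val a) (val b)
      = ‖val b‖ ^ 2 - ‖val a‖ ^ 2 + ‖val b - val a‖ ^ 2 := by
    rw [norm_sub_sq_real, inner_sub_left, real_inner_self_eq_norm_sq, real_inner_comm]
    ring
  rw [real_inner_smul_left] at h
  have hh : inner ℝ (val b - val a) (val b) + Δt * (wForm (fun _ => κmax) b b
      - wForm (fun x => κmax - w x) a b) + Δt * D = Δt * R := by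
    rw [← h]; field_simp; ring
  have hna := mul_nonneg hΔt.le (wGradSq_nonneg hw0 a)
  have hpol' := congrArg (Δt * ·) hpol
  simp only at hpol'
  linarith

/-- Summation of one-step estimates: `e` is the energy, `p` the dissipation, `q` the coercive
term and `r` the load. -/
lemma sum_energy_steps {e p q r : ℕ → ℝ} {N : ℕ}
    (h : ∀ n < N, e (n + 1) + p n + q n ≤ e n + r n) :
    e N + ∑ n ∈ Finset.range N, p n + ∑ n ∈ Finset.range N, q n
      ≤ e 0 + ∑ n ∈ Finset.range N, r n := by
  induction N with
  | zero => simp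
  | succ N ih =>
    have h1 := ih fun n hn => h n (hn.trans N.lt_succ_self)
    have h2 := h N N.lt_succ_self
    simp only [Finset.sum_range_succ]
    linarith

/-- The load is absorbed by half of the coercive term under Dirichlet conditions. -/
lemma absorb_load_gradient {κmin F G y R : ℝ} (hκ : 0 < κmin) (hR : R ≤ F * y)
    (hy : κmin * y ^ 2 ≤ G) : 2 * R ≤ G / 2 + 2 / κmin * F ^ 2 := by
  have h : 0 ≤ (κmin * y - 2 * F) ^ 2 / (2 * κmin) := by positivity
  have : (κmin * y - 2 * F) ^ 2 / (2 * κmin) = κmin * y ^ 2 / 2 - 2 * (F * y)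
      + 2 / κmin * F ^ 2 := by
    field_simp; ring
  linarith

/-- The load is absorbed by three quarters of the coercive term under Robin conditions. -/
lemma absorb_load_boundary {κmin CP F B M y R : ℝ} (hκ : 0 < κmin) (hC : 0 < CP)
    (hR : R ≤ (F + B) * y) (hy : κmin * y ^ 2 ≤ M) :
    2 * R ≤ 3 / 8 * CP ^ 2 * M + 4 / (CP ^ 2 * κmin) * (F ^ 2 + 2 * B ^ 2) := by
  have hk : 0 < CP ^ 2 * κmin := by positivity
  -- the weighted Cauchy–Schwarz inequality `(F + B)² ≤ (1 + 1/2) (F² + 2 B²)`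
  have h1 : (F + B) ^ 2 ≤ 3 / 2 * (F ^ 2 + 2 * B ^ 2) := by nlinarith [sq_nonneg (F - 2 * B)]
  have h2 : 0 ≤ (3 * (CP ^ 2 * κmin) * y - 8 * (F + B)) ^ 2 / (24 * (CP ^ 2 * κmin)) := by
    positivity
  have h3 : (3 * (CP ^ 2 * κmin) * y - 8 * (F + B)) ^ 2 / (24 * (CP ^ 2 * κmin))
      = 3 / 8 * CP ^ 2 * (κmin * y ^ 2) - 2 * ((F + B) * y)
        + 4 / (CP ^ 2 * κmin) * (2 / 3 * (F + B) ^ 2) := by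
    field_simp; ring
  have h4 : 3 / 8 * CP ^ 2 * (κmin * y ^ 2) ≤ 3 / 8 * CP ^ 2 * M := by gcongr
  have h5 : 4 / (CP ^ 2 * κmin) * (2 / 3 * (F + B) ^ 2)
      ≤ 4 / (CP ^ 2 * κmin) * (F ^ 2 + 2 * B ^ 2) := by
    gcongr; linarith
  linarith

lemma IsConductivity.measurable_comp {κmin κmax : ℝ} {κ : ℝ → ℝ}
    (hκ : IsConductivity κmin κmax κ) (u : H1 Ω) : Measurable fun x => κ (val u x) :=
  hκ.contDiff.continuous.measurable.comp (Lp.stronglyMeasurable (val u)).measurable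

lemma IsConductivity.abs_le {κmin κmax : ℝ} {κ : ℝ → ℝ} (hκmin : 0 < κmin)
    (hκ : IsConductivity κmin κmax κ) (t : ℝ) : |κ t| ≤ κmax := by
  rw [abs_of_nonneg (hκmin.le.trans (hκ.lower t))]
  exact hκ.upper t

theorem energy_estimate_dirichlet {ΓD : Set (Pt d)} {κmin κmax : ℝ} (hκmin : 0 < κmin)
    {κ : ℝ → ℝ} (hκ : IsConductivity κmin κmax κ) {𝒯 : Set (Set (Pt d))} {l : ℕ} {N : ℕ} {Δt : ℝ}
    (hΔt : 0 < Δt) {f : ℝ → StrongDual ℝ (Y Ω ΓD)} {T : ℕ → Y Ω ΓD}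
    (hT : SchemeA κmax κ 𝒯 l Δt N f T) :
    energyDissipation κmax κ Δt N (fun n => (T n).toH1)
        + Δt / 2 * ∑ n ∈ Finset.range N,
            wGradSq (fun x => κ (val (T n).toH1 x)) (T (n + 1)).toH1
      ≤ ‖val (T 0).toH1‖ ^ 2 + Δt * wGradSq (fun _ => κmax) (T 0).toH1
        + 2 * Δt / κmin * ∑ n ∈ Finset.range N, ‖f ((n + 1 : ℝ) * Δt)‖ ^ 2 := by
  rw [energyDissipation, Finset.mul_sum, Finset.mul_sum]
  refine sum_energy_steps
    (e := fun n => ‖val (T n).toH1‖ ^ 2 + Δt * wGradSq (fun _ => κmax) (T n).toH1) ?_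
  intro n hn
  have hw := hκ.measurable_comp (T n).toH1
  have hM : ∀ x, |κ (val (T n).toH1 x)| ≤ κmax := fun x => hκ.abs_le hκmin _
  have hstep := energy_step (κmax := κmax) (D := 0)
    (R := f ((n + 1 : ℝ) * Δt) (T (n + 1))) hΔt hw (fun x => hκmin.le.trans (hκ.lower _)) hM
    (T n).toH1 (T (n + 1)).toH1
    ((add_zero _).trans (hT.2 n hn (T (n + 1)) (hT.1 (n + 1) hn)))
  have hload := absorb_load_gradient hκmin
    (by simpa only [Y.norm_def] using
      (le_abs_self _).trans ((f ((n + 1 : ℝ) * Δt)).le_opNorm (T (n + 1))))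
    (le_wGradSq hw (fun x => hκ.lower _) hM (T (n + 1)).toH1)
  have hload' := mul_le_mul_of_nonneg_left hload hΔt.le
  have e1 : 2 * Δt / κmin * ‖f ((n + 1 : ℝ) * Δt)‖ ^ 2
      = Δt * (2 / κmin * ‖f ((n + 1 : ℝ) * Δt)‖ ^ 2) := by ring
  rw [e1]
  linarith

theorem energy_estimate_robin {κmin κmax α CP : ℝ} (hκmin : 0 < κmin) (hCP : 0 < CP)
    (hP : IsPoincareConst Ω κmin κmax α CP)
    {κ : ℝ → ℝ} (hκ : IsConductivity κmin κmax κ) {𝒯 : Set (Set (Pt d))} {l : ℕ} {N : ℕ} {Δt : ℝ}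
    (hΔt : 0 < Δt) {f : ℝ → StrongDual ℝ (H1 Ω)} {β : BdryDual Ω} {T : ℕ → H1 Ω}
    {τ : ℕ → L2Bdry Ω} (hα : 0 ≤ α) (hT : SchemeB κmax α κ 𝒯 l Δt N f β T τ) :
    energyDissipation κmax κ Δt N T
        + CP ^ 2 * Δt / 8 * ∑ n ∈ Finset.range N, wH1Sq (fun x => κ (val (T n) x)) (T (n + 1))
      ≤ ‖val (T 0)‖ ^ 2 + Δt * wGradSq (fun _ => κmax) (T 0)
        + 4 * Δt / (CP ^ 2 * κmin) * ∑ n ∈ Finset.range N,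
            (‖f ((n + 1 : ℝ) * Δt)‖ ^ 2 + 2 * ‖β‖ ^ 2) := by
  rw [energyDissipation, Finset.mul_sum, Finset.mul_sum]
  refine sum_energy_steps
    (e := fun n => ‖val (T n)‖ ^ 2 + Δt * wGradSq (fun _ => κmax) (T n)) ?_
  intro n hn
  obtain ⟨hX, hτ⟩ := hT.1 (n + 1) hn
  have hw := hκ.measurable_comp (T n)
  have hM : ∀ x, |κ (val (T n) x)| ≤ κmax := fun x => hκ.abs_le hκmin _
  have hstep := energy_step hΔt hw (fun x => hκmin.le.trans (hκ.lower _)) hM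
    (T n) (T (n + 1)) (hT.2 n hn (T (n + 1)) hX (τ (n + 1)) hτ)
  rw [real_inner_self_eq_norm_sq] at hstep
  have hcoer := hP _ hw (fun x => ⟨hκ.lower _, hκ.upper _⟩) (T (n + 1)) (τ (n + 1)) hτ
  have hload := absorb_load_boundary (F := ‖f ((n + 1 : ℝ) * Δt)‖) (B := ‖β‖) hκmin hCP
    (R := f ((n + 1 : ℝ) * Δt) (T (n + 1)) + (β : StrongDual ℝ (H1 Ω)) (T (n + 1)))
    (by
      rw [add_mul ‖f ((n + 1 : ℝ) * Δt)‖]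
      exact add_le_add
        ((Real.le_norm_self _).trans ((f ((n + 1 : ℝ) * Δt)).le_opNorm _))
        ((Real.le_norm_self _).trans ((β : StrongDual ℝ (H1 Ω)).le_opNorm _)))
    (le_wH1Sq hw (fun x => hκ.lower _) hM (T (n + 1)))
  have hload' := mul_le_mul_of_nonneg_left hload hΔt.le
  have hcoer' := mul_le_mul_of_nonneg_left hcoer hΔt.le
  have hbdry : 0 ≤ Δt * (α * ‖τ (n + 1)‖ ^ 2) := by positivity
  have e1 : 4 * Δt / (CP ^ 2 * κmin) * (‖f ((n + 1 : ℝ) * Δt)‖ ^ 2 + 2 * ‖β‖ ^ 2)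
      = Δt * (4 / (CP ^ 2 * κmin) * (‖f ((n + 1 : ℝ) * Δt)‖ ^ 2 + 2 * ‖β‖ ^ 2)) := by ring
  rw [e1]
  linarith

end Energy

/-! ### Slicing along the first coordinate -/

/-- The point of `ℝ^(m+1)` with first coordinate `t` and remaining coordinates `y`. -/
def consPt {m : ℕ} (t : ℝ) (y : Pt m) : Pt (m + 1) :=
  WithLp.toLp 2 (Fin.cons t y.ofLp : Fin (m + 1) → ℝ)

/-- The orthogonal projection `ℝ^(m+1) → ℝ^m` forgetting the first coordinate. -/
def tailPt {m : ℕ} (x : Pt (m + 1)) : Pt m := WithLp.toLp 2 fun i => x i.succ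

variable {m : ℕ}

@[simp] lemma consPt_zero (t : ℝ) (y : Pt m) : consPt t y 0 = t := rfl

@[simp] lemma consPt_succ (t : ℝ) (y : Pt m) (i : Fin m) : consPt t y i.succ = y i := rfl

@[simp] lemma tailPt_apply (x : Pt (m + 1)) (i : Fin m) : tailPt x i = x i.succ := rfl

@[simp] lemma tailPt_consPt (t : ℝ) (y : Pt m) : tailPt (consPt t y) = y := rfl

lemma lipschitzWith_tailPt : LipschitzWith 1 (tailPt (m := m)) := by
  refine LipschitzWith.of_dist_le_mul fun x y => ?_
  rw [NNReal.coe_one, one_mul, EuclideanSpace.dist_eq, EuclideanSpace.dist_eq]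
  refine Real.sqrt_le_sqrt ?_
  rw [Fin.sum_univ_succ]
  simp only [tailPt_apply]
  exact le_add_of_nonneg_left (sq_nonneg _)

lemma consPt_eq (t : ℝ) (y : Pt m) :
    consPt t y = t • EuclideanSpace.single (0 : Fin (m + 1)) (1 : ℝ) + consPt 0 y := by
  ext i
  refine Fin.cases ?_ (fun j => ?_) i <;> simp

lemma continuous_consPt : Continuous fun p : ℝ × Pt m => consPt p.1 p.2 := by
  refine (PiLp.continuous_toLp 2 _).comp (continuous_pi fun i => ?_)
  refine Fin.cases ?_ (fun j => ?_) i
  · exact continuous_fst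
  · exact (EuclideanSpace.proj j).continuous.comp continuous_snd

lemma continuous_consPt_left (y : Pt m) : Continuous fun t => consPt t y :=
  continuous_consPt.comp (continuous_id.prodMk continuous_const)

lemma continuous_consPt_right (t : ℝ) : Continuous fun y : Pt m => consPt t y :=
  continuous_consPt.comp (continuous_const.prodMk continuous_id)

lemma hasDerivAt_consPt (y : Pt m) (t : ℝ) :
    HasDerivAt (fun t => consPt t y) (EuclideanSpace.single (0 : Fin (m + 1)) (1 : ℝ)) t := by
  have h := ((hasDerivAt_id t).smul_const
    (EuclideanSpace.single (0 : Fin (m + 1)) (1 : ℝ))).add_const (consPt 0 y)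
  rw [one_smul] at h
  exact h.congr_of_eventuallyEq (Filter.Eventually.of_forall fun s => consPt_eq s y)

lemma measurePreserving_consPt :
    MeasurePreserving (fun p : ℝ × Pt m => consPt p.1 p.2) (volume.prod volume) volume := by
  have h1 := (MeasurePreserving.id (volume : Measure ℝ)).prod
    (EuclideanSpace.volume_preserving_symm_measurableEquiv_toLp (Fin m))
  have h2 := (volume_preserving_piFinSuccAbove (fun _ : Fin (m + 1) => ℝ) 0).symm
  have h3 := (EuclideanSpace.volume_preserving_symm_measurableEquiv_toLp (Fin (m + 1))).symm
  have e : (fun p : ℝ × Pt m => consPt p.1 p.2)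
      = (MeasurableEquiv.toLp 2 (Fin (m + 1) → ℝ)).symm.symm
        ∘ (MeasurableEquiv.piFinSuccAbove (fun _ => ℝ) 0).symm
        ∘ Prod.map id (MeasurableEquiv.toLp 2 (Fin m → ℝ)).symm := by
    funext p
    ext i
    refine Fin.cases ?_ (fun j => ?_) i <;> rfl
  rw [e]
  exact h3.comp (h2.comp h1)

lemma lintegral_eq_lintegral_consPt {g : Pt (m + 1) → ℝ≥0∞} (hg : Measurable g) :
    ∫⁻ x, g x = ∫⁻ y : Pt m, ∫⁻ t : ℝ, g (consPt t y) := by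
  rw [← measurePreserving_consPt.lintegral_comp hg, lintegral_prod_symm
    (fun p : ℝ × Pt m => g (consPt p.1 p.2)) (hg.comp measurePreserving_consPt.measurable).aemeasurable]

/-- The shadow of `Ω` under the projection forgetting the first coordinate. -/
def shadow (Ω : Set (Pt (m + 1))) : Set (Pt m) := {y | ∃ t, consPt t y ∈ Ω}

/-- The line through `y` in the first coordinate direction, intersected with `Ω`. -/
def slice (Ω : Set (Pt (m + 1))) (y : Pt m) : Set ℝ := {t | consPt t y ∈ Ω}

/-- The lower end of the slice of `Ω` over `y`; it is `0` if the slice is empty. -/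
noncomputable def lowerEnd (Ω : Set (Pt (m + 1))) (y : Pt m) : ℝ := sInf (slice Ω y)

/-- The point at the lower end of the slice of `Ω` over `y`. -/
noncomputable def lowerPt (Ω : Set (Pt (m + 1))) (y : Pt m) : Pt (m + 1) := consPt (lowerEnd Ω y) y

variable {Ω : Set (Pt (m + 1))}

lemma isOpen_slice (hΩ : IsOpen Ω) (y : Pt m) : IsOpen (slice Ω y) :=
  hΩ.preimage (continuous_consPt_left y)

lemma isOpen_shadow (hΩ : IsOpen Ω) : IsOpen (shadow Ω) := by
  have : shadow Ω = ⋃ t : ℝ, (fun y => consPt t y) ⁻¹' Ω := by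
    ext y; simp [shadow]
  rw [this]
  exact isOpen_iUnion fun t => hΩ.preimage (continuous_consPt_right t)

lemma slice_subset_Icc {R : ℝ} (hR : Ω ⊆ Metric.closedBall 0 R) (y : Pt m) :
    slice Ω y ⊆ Icc (-R) R := by
  intro t ht
  have h1 : ‖consPt t y‖ ≤ R := mem_closedBall_zero_iff.1 (hR ht)
  have h2 := PiLp.norm_apply_le (consPt t y) 0
  rw [consPt_zero] at h2
  exact abs_le.1 (h2.trans h1)

lemma convex_slice (hΩ : Convex ℝ Ω) (y : Pt m) : Convex ℝ (slice Ω y) := by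
  intro s hs t ht a b ha hb hab
  have h := hΩ hs ht ha hb hab
  have e : consPt (a • s + b • t) y = a • consPt s y + b • consPt t y := by
    ext i
    refine Fin.cases ?_ (fun j => ?_) i
    · simp
    · simp [← add_mul, hab]
  rwa [slice, mem_ofPred_eq, e]

lemma slice_eq_Ioo (hΩ : IsOpen Ω) (hc : Convex ℝ Ω) {R : ℝ}
    (hR : Ω ⊆ Metric.closedBall 0 R) {y : Pt m} (hy : y ∈ shadow Ω) :
    slice Ω y = Ioo (lowerEnd Ω y) (sSup (slice Ω y)) := by
  have hb : BddBelow (slice Ω y) := bddBelow_Icc.mono (slice_subset_Icc hR y)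
  have ha : BddAbove (slice Ω y) := bddAbove_Icc.mono (slice_subset_Icc hR y)
  refine Subset.antisymm ?_ (IsConnected.Ioo_csInf_csSup_subset
    ⟨hy, (convex_slice hc y).isPreconnected⟩ hb ha)
  rw [← interior_Icc]
  exact interior_maximal (fun t ht => ⟨csInf_le hb ht, le_csSup ha ht⟩) (isOpen_slice hΩ y)

lemma lowerPt_mem_frontier (hΩ : IsOpen Ω) (hc : Convex ℝ Ω) {R : ℝ}
    (hR : Ω ⊆ Metric.closedBall 0 R) {y : Pt m} (hy : y ∈ shadow Ω) :
    lowerPt Ω y ∈ frontier Ω := by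
  rw [hΩ.frontier_eq]
  have hne : (slice Ω y).Nonempty := hy
  have hb : BddBelow (slice Ω y) := bddBelow_Icc.mono (slice_subset_Icc hR y)
  constructor
  · exact map_mem_closure (f := fun t => consPt t y) (continuous_consPt_left y)
      (csInf_mem_closure hne hb) fun t ht => ht
  · intro h
    have h' : lowerEnd Ω y ∈ slice Ω y := h
    rw [slice_eq_Ioo hΩ hc hR hy] at h'
    exact lt_irrefl _ h'.1

/-- The lower end is upper semicontinuous on the shadow, since `Ω` is open. -/
lemma measurable_lowerEnd (hΩ : IsOpen Ω) {R : ℝ} (hR : Ω ⊆ Metric.closedBall 0 R) :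
    Measurable (lowerEnd Ω) := by
  refine measurable_of_Iio fun c => ?_
  have : lowerEnd Ω ⁻¹' Iio c = (⋃ t ∈ Iio c, (fun y => consPt t y) ⁻¹' Ω)
      ∪ ((shadow Ω)ᶜ ∩ {_y | 0 < c}) := by
    ext y
    have hb : BddBelow (slice Ω y) := bddBelow_Icc.mono (slice_subset_Icc hR y)
    simp only [mem_preimage, mem_Iio, mem_union, mem_iUnion, mem_inter_iff, mem_compl_iff,
      mem_ofPred_eq, exists_prop]
    by_cases hy : y ∈ shadow Ω
    · simp only [hy, not_true_eq_false, false_and, or_false]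
      rw [lowerEnd, csInf_lt_iff hb hy]
      exact exists_congr fun t => and_comm
    · have he : slice Ω y = ∅ := by
        rw [eq_empty_iff_forall_notMem]; exact fun t ht => hy ⟨t, ht⟩
      have h0 : ¬ ∃ t, t < c ∧ consPt t y ∈ Ω := fun ⟨t, _, ht⟩ => hy ⟨t, ht⟩
      simp [hy, h0, lowerEnd, he]
  rw [this]
  refine MeasurableSet.union (IsOpen.measurableSet ?_) ?_
  · exact isOpen_biUnion fun t _ => hΩ.preimage (continuous_consPt_right t)
  · exact (isOpen_shadow hΩ).measurableSet.compl.inter (MeasurableSet.const _)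

lemma measurable_lowerPt (hΩ : IsOpen Ω) {R : ℝ} (hR : Ω ⊆ Metric.closedBall 0 R) :
    Measurable (lowerPt Ω) :=
  continuous_consPt.measurable.comp ((measurable_lowerEnd hΩ hR).prodMk measurable_id)

/-- A `1`-Lipschitz projection does not increase Hausdorff measure, so the surface measure of the
lower boundary dominates the Lebesgue measure of its shadow. -/
lemma map_lowerPt_le_surf (hΩ : IsOpen Ω) (hc : Convex ℝ Ω) {R : ℝ}
    (hR : Ω ⊆ Metric.closedBall 0 R) :
    (volume.restrict (shadow Ω)).map (lowerPt Ω) ≤ surf Ω := by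
  refine Measure.le_iff.2 fun B hB => ?_
  have hm := measurable_lowerPt hΩ hR
  rw [Measure.map_apply hm hB, Measure.restrict_apply (hm hB), surf, Measure.restrict_apply hB,
    Nat.add_sub_cancel]
  have hsub : lowerPt Ω ⁻¹' B ∩ shadow Ω ⊆ tailPt '' (B ∩ frontier Ω) := fun y hy =>
    ⟨lowerPt Ω y, ⟨hy.1, lowerPt_mem_frontier hΩ hc hR hy.2⟩, tailPt_consPt _ _⟩
  refine (measure_mono hsub).trans ?_
  rw [← EuclideanSpace.euclideanHausdorffMeasure_eq_volume]
  simp only [Measure.euclideanHausdorffMeasure_def, Measure.smul_apply]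
  gcongr
  simpa using lipschitzWith_tailPt.hausdorffMeasure_image_le (Nat.cast_nonneg m) (B ∩ frontier Ω)

/-! ### The Poincaré inequality with boundary term -/

/-- One-dimensional Poincaré inequality controlling the mean square by the left endpoint value. -/
lemma integral_sq_le_endpoint {a b L : ℝ} {u u' : ℝ → ℝ} (hab : a ≤ b) (hL : b - a ≤ L)
    (hu : ∀ t, HasDerivAt u (u' t) t) (hu' : Continuous u') :
    ∫ t in a..b, u t ^ 2 ≤ 2 * L * u a ^ 2 + 4 * L ^ 2 * ∫ t in a..b, u' t ^ 2 := by
  have hc : Continuous u := continuous_iff_continuousAt.2 fun t => (hu t).continuousAt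
  -- integrate the derivative of `(t - b) u(t)²`, which vanishes at `b`
  have hd : ∀ t, HasDerivAt (fun t => (t - b) * u t ^ 2)
      (u t ^ 2 + 2 * (t - b) * u t * u' t) t := fun t => by
    have := ((hasDerivAt_id t).sub_const b).mul ((hu t).pow 2)
    refine this.congr_deriv ?_
    simp; ring
  have hftc := intervalIntegral.integral_eq_sub_of_hasDerivAt (a := a) (b := b)
    (fun t _ => hd t) (by apply Continuous.intervalIntegrable; fun_prop)
  have hmono : ∫ t in a..b, (1 / 2 * u t ^ 2 - 2 * L ^ 2 * u' t ^ 2)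
      ≤ ∫ t in a..b, (u t ^ 2 + 2 * (t - b) * u t * u' t) := by
    refine intervalIntegral.integral_mono_on hab
      (by apply Continuous.intervalIntegrable; fun_prop)
      (by apply Continuous.intervalIntegrable; fun_prop) fun t ht => ?_
    have h1 : (t - b) ^ 2 ≤ L ^ 2 := by
      rw [mem_Icc] at ht
      nlinarith
    have h2 := mul_le_mul_of_nonneg_right h1 (sq_nonneg (u' t))
    nlinarith [sq_nonneg (u t + 2 * (t - b) * u' t)]
  rw [intervalIntegral.integral_sub (by apply Continuous.intervalIntegrable; fun_prop)
    (by apply Continuous.intervalIntegrable; fun_prop), intervalIntegral.integral_const_mul,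
    intervalIntegral.integral_const_mul, hftc] at hmono
  have h3 := mul_le_mul_of_nonneg_right hL (sq_nonneg (u a))
  linarith

/-- The one-dimensional inequality for a smooth function along a slice. -/
lemma lintegral_slice_sq_le {a b L : ℝ} (hab : a ≤ b) (hL : b - a ≤ L) {φ : Pt (m + 1) → ℝ}
    (hφ : ContDiff ℝ ∞ φ) (y : Pt m) :
    ∫⁻ t in Ioo a b, ENNReal.ofReal (φ (consPt t y) ^ 2)
      ≤ ENNReal.ofReal (2 * L) * ENNReal.ofReal (φ (consPt a y) ^ 2)
        + ENNReal.ofReal (4 * L ^ 2)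
          * ∫⁻ t in Ioo a b, ENNReal.ofReal (‖gradient φ (consPt t y)‖ ^ 2) := by
  set e : Pt (m + 1) := EuclideanSpace.single (0 : Fin (m + 1)) (1 : ℝ)
  have hL0 : 0 ≤ L := (sub_nonneg.2 hab).trans hL
  have hu : ∀ t, HasDerivAt (fun t => φ (consPt t y)) (fderiv ℝ φ (consPt t y) e) t := fun t =>
    ((hφ.differentiable (by simp)) _).hasFDerivAt.comp_hasDerivAt t (hasDerivAt_consPt y t)
  have hu' : Continuous fun t => fderiv ℝ φ (consPt t y) e :=
    ((hφ.continuous_fderiv (by simp)).comp (continuous_consPt_left y)).clm_apply continuous_const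
  have hc : Continuous fun t => φ (consPt t y) := hφ.continuous.comp (continuous_consPt_left y)
  have key := integral_sq_le_endpoint hab hL hu hu'
  have hle : ∀ t, (fderiv ℝ φ (consPt t y) e) ^ 2 ≤ ‖gradient φ (consPt t y)‖ ^ 2 := fun t => by
    have h1 : ‖gradient φ (consPt t y)‖ = ‖fderiv ℝ φ (consPt t y)‖ := by
      simp [gradient]
    have h2 := (fderiv ℝ φ (consPt t y)).le_opNorm e
    have h3 : ‖e‖ = 1 := by simp [e]
    rw [h3, mul_one, ← h1] at h2
    exact sq_le_sq' (neg_le_of_abs_le h2) (le_of_abs_le h2)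
  have conv : ∀ v : ℝ → ℝ, Continuous v →
      ∫⁻ t in Ioo a b, ENNReal.ofReal (v t ^ 2) = ENNReal.ofReal (∫ t in a..b, v t ^ 2) := by
    intro v hv
    rw [intervalIntegral.integral_of_le hab, integral_Ioc_eq_integral_Ioo,
      ofReal_integral_eq_lintegral_ofReal]
    · exact ((hv.pow 2).integrableOn_Icc).mono_set Ioo_subset_Icc_self
    · exact Filter.Eventually.of_forall fun t => sq_nonneg (v t)
  calc _ = ENNReal.ofReal (∫ t in a..b, φ (consPt t y) ^ 2) := conv _ hc
    _ ≤ _ := ENNReal.ofReal_le_ofReal key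
    _ ≤ ENNReal.ofReal (2 * L) * ENNReal.ofReal (φ (consPt a y) ^ 2)
        + ENNReal.ofReal (4 * L ^ 2)
          * ENNReal.ofReal (∫ t in a..b, (fderiv ℝ φ (consPt t y) e) ^ 2) := by
      rw [← ENNReal.ofReal_mul (by positivity), ← ENNReal.ofReal_mul (by positivity)]
      exact ENNReal.ofReal_add_le
    _ ≤ _ := by
      rw [← conv _ hu']
      refine add_le_add le_rfl (mul_le_mul_right ?_ _)
      exact lintegral_mono fun t => ENNReal.ofReal_le_ofReal (hle t)

lemma continuous_gradient {d : ℕ} {φ : Pt d → ℝ} (hφ : ContDiff ℝ ∞ φ) :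
    Continuous (gradient φ) :=
  (InnerProductSpace.toDual ℝ (Pt d)).symm.continuous.comp (hφ.continuous_fderiv (by simp))

/-- Integration over `Ω` as an iterated integral over the shadow and the slices. -/
lemma setLIntegral_eq_shadow_slice (hΩ : IsOpen Ω) {g : Pt (m + 1) → ℝ≥0∞} (hg : Measurable g) :
    ∫⁻ x in Ω, g x = ∫⁻ y in shadow Ω, ∫⁻ t in slice Ω y, g (consPt t y) := by
  rw [← lintegral_indicator hΩ.measurableSet,
    lintegral_eq_lintegral_consPt (hg.indicator hΩ.measurableSet),
    ← lintegral_indicator (isOpen_shadow hΩ).measurableSet]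
  refine lintegral_congr fun y => ?_
  have e1 : ∫⁻ t, Ω.indicator g (consPt t y) = ∫⁻ t in slice Ω y, g (consPt t y) := by
    rw [← lintegral_indicator (isOpen_slice hΩ y).measurableSet]
    rfl
  rw [e1]
  by_cases hy : y ∈ shadow Ω
  · rw [indicator_of_mem hy]
  · have he : slice Ω y = ∅ := by
      rw [eq_empty_iff_forall_notMem]; exact fun t ht => hy ⟨t, ht⟩
    rw [indicator_of_notMem hy, he, Measure.restrict_empty, lintegral_zero_measure]

/-- The Poincaré inequality for smooth functions: the slice inequalities integrated over the shadow,
with the values at the lower ends bounded by the full boundary integral. -/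
lemma lintegral_sq_le_surf (hΩ : IsOpen Ω) (hc : Convex ℝ Ω) {R : ℝ}
    (hR : Ω ⊆ Metric.closedBall 0 R) {φ : Pt (m + 1) → ℝ} (hφ : ContDiff ℝ ∞ φ) :
    ∫⁻ x in Ω, ENNReal.ofReal (φ x ^ 2)
      ≤ ENNReal.ofReal (2 * (2 * R)) * ∫⁻ x, ENNReal.ofReal (φ x ^ 2) ∂(surf Ω)
        + ENNReal.ofReal (4 * (2 * R) ^ 2) * ∫⁻ x in Ω, ENNReal.ofReal (‖gradient φ x‖ ^ 2) := by
  have m1 : Measurable fun x => ENNReal.ofReal (φ x ^ 2) :=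
    (hφ.continuous.pow 2).measurable.ennreal_ofReal
  have m2 : Measurable fun x => ENNReal.ofReal (‖gradient φ x‖ ^ 2) :=
    ((continuous_gradient hφ).norm.pow 2).measurable.ennreal_ofReal
  have hm := measurable_lowerPt hΩ hR
  have m3 : Measurable fun y => ENNReal.ofReal (φ (lowerPt Ω y) ^ 2) := m1.comp hm
  have hslice : ∀ y ∈ shadow Ω, ∫⁻ t in slice Ω y, ENNReal.ofReal (φ (consPt t y) ^ 2)
      ≤ ENNReal.ofReal (2 * (2 * R)) * ENNReal.ofReal (φ (lowerPt Ω y) ^ 2)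
        + ENNReal.ofReal (4 * (2 * R) ^ 2)
          * ∫⁻ t in slice Ω y, ENNReal.ofReal (‖gradient φ (consPt t y)‖ ^ 2) := by
    intro y hy
    have hne : (slice Ω y).Nonempty := hy
    have hsub := slice_subset_Icc hR y
    have hlow : -R ≤ lowerEnd Ω y := le_csInf hne fun t ht => (hsub ht).1
    have hupp : sSup (slice Ω y) ≤ R := csSup_le hne fun t ht => (hsub ht).2
    have hle : lowerEnd Ω y ≤ sSup (slice Ω y) :=
      csInf_le_csSup hne (bddBelow_Icc.mono hsub) (bddAbove_Icc.mono hsub)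
    have h := lintegral_slice_sq_le hle (L := 2 * R) (by linarith) hφ y
    rwa [← slice_eq_Ioo hΩ hc hR hy] at h
  have hbdry : ∫⁻ y in shadow Ω, ENNReal.ofReal (φ (lowerPt Ω y) ^ 2)
      ≤ ∫⁻ x, ENNReal.ofReal (φ x ^ 2) ∂(surf Ω) := by
    rw [← lintegral_map m1 hm]
    exact lintegral_mono' (map_lowerPt_le_surf hΩ hc hR) le_rfl
  rw [setLIntegral_eq_shadow_slice hΩ m1, setLIntegral_eq_shadow_slice hΩ m2]
  refine (setLIntegral_mono_ae' (isOpen_shadow hΩ).measurableSet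
    (Filter.Eventually.of_forall hslice)).trans ?_
  rw [lintegral_add_left (m3.const_mul _), lintegral_const_mul' _ _ ENNReal.ofReal_ne_top,
    lintegral_const_mul' _ _ ENNReal.ofReal_ne_top]
  gcongr

lemma ofReal_norm_sq_eq_lintegral {X E : Type*} [MeasurableSpace X] {μ : Measure X}
    [NormedAddCommGroup E] [InnerProductSpace ℝ E] (g : Lp E 2 μ) {φ : X → E} (h : g =ᵐ[μ] φ) :
    ENNReal.ofReal (‖g‖ ^ 2) = ∫⁻ x, ENNReal.ofReal (‖φ x‖ ^ 2) ∂μ := by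
  have hi : Integrable (fun x => ‖g x‖ ^ 2) μ := by
    simpa only [real_inner_self_eq_norm_sq] using L2.integrable_inner (𝕜 := ℝ) g g
  rw [norm_sq_eq_integral, ofReal_integral_eq_lintegral_ofReal hi
    (Filter.Eventually.of_forall fun x => sq_nonneg _)]
  refine lintegral_congr_ae ?_
  filter_upwards [h] with x hx
  rw [hx]

/-- The inequality passes from smooth functions to all of `H¹(Ω)` because the trace graph is the
closure of the graph over smooth functions. -/
lemma norm_val_sq_le_of_hasTrace (hΩ : IsOpen Ω) (hc : Convex ℝ Ω) {R : ℝ} (hR0 : 0 ≤ R)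
    (hR : Ω ⊆ Metric.closedBall 0 R) {u : H1 Ω} {s : L2Bdry Ω} (h : HasTrace u s) :
    ‖val u‖ ^ 2 ≤ 2 * (2 * R) * ‖s‖ ^ 2 + 4 * (2 * R) ^ 2 * ‖grad u‖ ^ 2 := by
  have cval : Continuous fun p : H1 Ω × L2Bdry Ω => val p.1 :=
    (WithLp.continuous_fst 2 (L2 Ω) (L2Vec Ω)).comp (continuous_subtype_val.comp continuous_fst)
  have cgrad : Continuous fun p : H1 Ω × L2Bdry Ω => grad p.1 :=
    (WithLp.continuous_snd 2 (L2 Ω) (L2Vec Ω)).comp (continuous_subtype_val.comp continuous_fst)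
  have hclosed : IsClosed {p : H1 Ω × L2Bdry Ω |
      ‖val p.1‖ ^ 2 ≤ 2 * (2 * R) * ‖p.2‖ ^ 2 + 4 * (2 * R) ^ 2 * ‖grad p.1‖ ^ 2} :=
    isClosed_le (by fun_prop) (by fun_prop)
  have hmem : (u, s) ∈ closure (smoothTraces Ω : Set (H1 Ω × L2Bdry Ω)) := h
  refine (hclosed.closure_subset_iff.2 ?_ hmem :)
  rintro p ⟨φ, hφ, h1, h2, h3⟩
  have key := lintegral_sq_le_surf hΩ hc hR hφ
  have e1 := ofReal_norm_sq_eq_lintegral _ h1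
  have e2 := ofReal_norm_sq_eq_lintegral _ h2
  have e3 := ofReal_norm_sq_eq_lintegral _ h3
  simp only [Real.norm_eq_abs, sq_abs] at e1 e3
  rw [← e1, ← e2, ← e3, ← ENNReal.ofReal_mul (by positivity), ← ENNReal.ofReal_mul (by positivity),
    ← ENNReal.ofReal_add (by positivity) (by positivity)] at key
  exact (ENNReal.ofReal_le_ofReal_iff (by positivity)).1 key

lemma exists_poincare_boundary {d : ℕ} (hd : 1 ≤ d) {Ω : Set (Pt d)} (hΩ : IsConvexPolytope Ω) :
    ∃ K : ℝ, 0 ≤ K ∧ ∀ (u : H1 Ω) (s : L2Bdry Ω), HasTrace u s →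
      ‖val u‖ ^ 2 ≤ K * (‖grad u‖ ^ 2 + ‖s‖ ^ 2) := by
  obtain ⟨m, rfl⟩ : ∃ m, d = m + 1 := ⟨d - 1, by omega⟩
  obtain ⟨-, F, rfl⟩ := hΩ
  obtain ⟨R, hR0, hR⟩ :=
    ((isBounded_convexHull.2 F.finite_toSet.isBounded).subset
      interior_subset).subset_closedBall_lt 0 (0 : Pt (m + 1))
  refine ⟨2 * (2 * R) + 4 * (2 * R) ^ 2, by positivity, fun u s h => ?_⟩
  have key := norm_val_sq_le_of_hasTrace isOpen_interior (convex_convexHull ℝ _).interior hR0.le hR h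
  have h1 : 0 ≤ 2 * (2 * R) * ‖grad u‖ ^ 2 := by positivity
  have h2 : 0 ≤ 4 * (2 * R) ^ 2 * ‖s‖ ^ 2 := by positivity
  linarith

/-- The constant is obtained from the unweighted inequality by `κmin ≤ w ≤ κmax`. If no weight
satisfies these bounds the claim is vacuous, hence `|κmax| + 1` as a positive upper bound. -/
lemma exists_isPoincareConst {d : ℕ} (hd : 1 ≤ d) {Ω : Set (Pt d)} (hΩ : IsConvexPolytope Ω)
    {κmin κmax α : ℝ} (hκmin : 0 < κmin) (hα : 0 < α) :
    ∃ CP : ℝ, 0 < CP ∧ IsPoincareConst Ω κmin κmax α CP := by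
  obtain ⟨K, hK0, hK⟩ := exists_poincare_boundary hd hΩ
  have hmin : 0 < min κmin α := lt_min hκmin hα
  have hden : 0 < (|κmax| + 1) * (K + 1) := by positivity
  refine ⟨√(2 * (min κmin α / ((|κmax| + 1) * (K + 1)))), by positivity, ?_⟩
  intro w hw hb S s hS
  have habs : ∀ x, |w x| ≤ |κmax| := fun x =>
    abs_le_abs_of_nonneg (hκmin.le.trans (hb x).1) (hb x).2
  have hgrad := le_wGradSq hw (fun x => (hb x).1) habs S
  have hH1 : wH1Sq w S ≤ (|κmax| + 1) * (K + 1) * (‖grad S‖ ^ 2 + ‖s‖ ^ 2) := by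
    have hn : ‖S‖ ^ 2 ≤ (K + 1) * (‖grad S‖ ^ 2 + ‖s‖ ^ 2) := by
      rw [norm_H1_sq]
      linarith [hK S s hS, sq_nonneg ‖s‖]
    rw [mul_assoc]
    exact (wH1Sq_le hw (fun x => (le_abs_self _).trans ((habs x).trans (lt_add_one _).le)) habs
      S).trans (mul_le_mul_of_nonneg_left hn (by positivity))
  rw [Real.sq_sqrt (by positivity), mul_div_cancel_left₀ _ two_ne_zero]
  calc _ ≤ min κmin α / ((|κmax| + 1) * (K + 1))
        * ((|κmax| + 1) * (K + 1) * (‖grad S‖ ^ 2 + ‖s‖ ^ 2)) :=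
        mul_le_mul_of_nonneg_left hH1 (by positivity)
    _ = min κmin α * ‖grad S‖ ^ 2 + min κmin α * ‖s‖ ^ 2 := by field_simp
    _ ≤ κmin * ‖grad S‖ ^ 2 + α * ‖s‖ ^ 2 := by
      gcongr
      · exact min_le_left _ _
      · exact min_le_right _ _
    _ ≤ _ := by gcongr

end HeatIMEX

theorem theorem1 {d : ℕ} (hd : 1 ≤ d) (Ω : Set (HeatIMEX.Pt d))
    (hΩ : HeatIMEX.IsConvexPolytope Ω) (κmin κmax : ℝ) (hκmin : 0 < κmin) :
    -- (a) mixed Dirichlet / Neumann conditions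
    (∀ ΓD ΓN : Set (HeatIMEX.Pt d), HeatIMEX.IsBoundaryPartition Ω ΓD ΓN →
      ∀ κ : ℝ → ℝ, HeatIMEX.IsConductivity κmin κmax κ →
      ∀ (𝒯 : Set (Set (HeatIMEX.Pt d))) (l : ℕ), HeatIMEX.IsMesh Ω 𝒯 →
      ∀ (tstar : ℝ) (N : ℕ) (Δt : ℝ), 0 < tstar → 1 ≤ N → Δt = tstar / N →
      ∀ (f : ℝ → StrongDual ℝ (HeatIMEX.Y Ω ΓD)) (T : ℕ → HeatIMEX.Y Ω ΓD),
        HeatIMEX.SchemeA κmax κ 𝒯 l Δt N f T →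
        HeatIMEX.energyDissipation κmax κ Δt N (fun n => (T n).toH1)
          + Δt / 2 * ∑ n ∈ Finset.range N,
              HeatIMEX.wGradSq (fun x => κ (HeatIMEX.val (T n).toH1 x)) (T (n + 1)).toH1
        ≤ ‖HeatIMEX.val (T 0).toH1‖ ^ 2
          + Δt * HeatIMEX.wGradSq (fun _ => κmax) (T 0).toH1
          + 2 * Δt / κmin * ∑ n ∈ Finset.range N, ‖f ((n + 1 : ℝ) * Δt)‖ ^ 2) ∧
    -- (b) Robin conditions
    (∀ α : ℝ, 0 < α → α ≤ 1 →
      ∃ CP : ℝ, 0 < CP ∧ HeatIMEX.IsPoincareConst Ω κmin κmax α CP ∧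
      ∀ κ : ℝ → ℝ, HeatIMEX.IsConductivity κmin κmax κ →
      ∀ (𝒯 : Set (Set (HeatIMEX.Pt d))) (l : ℕ), HeatIMEX.IsMesh Ω 𝒯 →
      ∀ (tstar : ℝ) (N : ℕ) (Δt : ℝ), 0 < tstar → 1 ≤ N → Δt = tstar / N →
      ∀ (f : ℝ → StrongDual ℝ (HeatIMEX.H1 Ω)) (β : HeatIMEX.BdryDual Ω)
        (T : ℕ → HeatIMEX.H1 Ω) (τ : ℕ → HeatIMEX.L2Bdry Ω),
        HeatIMEX.SchemeB κmax α κ 𝒯 l Δt N f β T τ →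
        HeatIMEX.energyDissipation κmax κ Δt N T
          + CP ^ 2 * Δt / 8 * ∑ n ∈ Finset.range N,
              HeatIMEX.wH1Sq (fun x => κ (HeatIMEX.val (T n) x)) (T (n + 1))
        ≤ ‖HeatIMEX.val (T 0)‖ ^ 2 + Δt * HeatIMEX.wGradSq (fun _ => κmax) (T 0)
          + 4 * Δt / (CP ^ 2 * κmin) * ∑ n ∈ Finset.range N,
              (‖f ((n + 1 : ℝ) * Δt)‖ ^ 2 + 2 * ‖β‖ ^ 2)) := by
  refine ⟨?_, ?_⟩
  · intro ΓD ΓN _ κ hκ 𝒯 l _ tstar N Δt ht hN hΔt f T hT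
    have hpos : 0 < Δt := hΔt ▸ div_pos ht (Nat.cast_pos.2 hN)
    exact HeatIMEX.energy_estimate_dirichlet hκmin hκ hpos hT
  · intro α hα _
    obtain ⟨CP, hCP, hP⟩ := HeatIMEX.exists_isPoincareConst (κmax := κmax) hd hΩ hκmin hα
    refine ⟨CP, hCP, hP, ?_⟩
    intro κ hκ 𝒯 l _ tstar N Δt ht hN hΔt f β T τ hT
    have hpos : 0 < Δt := hΔt ▸ div_pos ht (Nat.cast_pos.2 hN)
    exact HeatIMEX.energy_estimate_robin hκmin hCP hP hκ hpos hα.le hT
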